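/- Let $(\Omega,\mathcal F,\mathbb P)$ be a probability space and $\theta:\Omega\to\Omega$ a measurable bijection with measurable inverse, such that $\mathbb P$ is stationary and ergodic under $\theta$ (the Palm space of the arrival process). Let $\sigma\ge 0$ (service time) and $\xi>0$ (inter-arrival time), a.s., be integrable real random variables, and write $\sigma_n=\sigma\circ\theta^n$, $\xi_n=\xi\circ\theta^n$ for $n\in\mathbb Z$. Let $\mathcal M$ be the set of finite counting measures on $[0,\infty)$, i.e. of finite sums, possibly empty and counted with multiplicity, of Dirac masses at points of $[0,\infty)$. For $\mu\in\mathcal M$ let $Z(\mu)$ be its largest atom ($Z(\mathbf 0)=0$). For $y\in\mathbb R$ let $\tau_y\mu$ be the measure with $\int f\,d(\tau_y\mu)=\int f(x-y)\mathbf 1_{\{x>y\}}\,\mu(dx)$. Random profiles are random measures that are a.s. in $\mathcal M$. The service profile sequence of the G/G/$\infty$ (pure delay) queue with initial random profile $\zeta$ is $$\mu^{[\zeta]}_0=\zeta,\qquad \mu^{[\zeta]}_{n+1}=\tau_{\xi_n}\bigl(\mu^{[\zeta]}_n+\delta_{\sigma_n}\bigr),\quad n\ge 0,$$ and a stationary service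 profile is a random profile $\mu$ such that, a.s., $$\mu\circ\theta=\tau_{\xi}(\mu+\delta_\sigma).\qquad(*)$$ Put $L=\Bigl[\sup_{j\ge 1}\bigl(\sigma_{-j}-\sum_{i=1}^{j}\xi_{-i}\bigr)\Bigr]^+$ (with values in $[0,\infty]$) and $$\mu^{\mathrm{PD}}=\sum_{i=1}^{\infty}\delta_{\sigma_{-i}-\sum_{j=1}^{i}\xi_{-j}}\,\mathbf 1_{\{\sigma_{-i}>\sum_{j=1}^{i}\xi_{-j}\}}.$$ **Theorem.** The random measure $\mu^{\mathrm{PD}}$ is a.s. in $\mathcal M$ (in particular a.s. finite) and is a solution of $(*)$. If moreover $\mathbb P(L\le 0)>0$, then 1. every random profile $\mu$ solving $(*)$ satisfies $\mu=\mu^{\mathrm{PD}}$ a.s.; 2. for every random profile $\zeta$ with $Z(\zeta)\le L$ a.s., the sequence $(\mu_n^{[\zeta]})_{n\ge0}$ converges to $\mu^{\mathrm{PD}}$ with strong backwards coupling, i.e. a.s. there is a finite $N$ such that $\mu^{[\zeta]}_n\circ\theta^{-n}=\mu^{\mathrm{PD}}$ for all $n\ge N$. -/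

import Mathlib

open MeasureTheory

noncomputable section

namespace PureDelay

/-- The finite counting measures on `[0, ∞)`, i.e. the finite sums (with multiplicity) of Dirac
masses at nonnegative points. These are the possible service profiles. -/
def IsProfile (μ : Measure ℝ) : Prop :=
  ∃ s : Multiset ℝ, (∀ x ∈ s, 0 ≤ x) ∧ μ = (s.map Measure.dirac).sum

/-- The largest atom `Z(μ)` of a profile, with the convention `max ∅ = 0`
(the set of atoms of a profile is finite, and `sSup ∅ = 0` in `ℝ`). -/
def largestAtom (μ : Measure ℝ) : ℝ :=
  sSup {x : ℝ | μ {x} ≠ 0}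

/-- The translated and truncated measure `τ_y μ`, given by
`∫ f d(τ_y μ) = ∫ f (x - y) 1{x > y} μ(dx)`. -/
def shift (y : ℝ) (μ : Measure ℝ) : Measure ℝ :=
  (μ.restrict (Set.Ioi y)).map (fun x => x - y)

variable {Ω : Type*} [MeasurableSpace Ω]

/-- `σ_{-i} - ∑_{j=1}^{i} ξ_{-j}`, where `X_{-i} = X ∘ θ^{-i}`: the signed residual service time,
at the arrival of customer `0`, of the customer who arrived `i` steps earlier. -/
def residual (θ : Ω ≃ᵐ Ω) (σ ξ : Ω → ℝ) (i : ℕ) (ω : Ω) : ℝ :=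
  σ (θ.symm^[i] ω) - ∑ j ∈ Finset.Icc 1 i, ξ (θ.symm^[j] ω)

/-- `L = [sup_{j ≥ 1} (σ_{-j} - ∑_{i=1}^{j} ξ_{-i})]^+`; the supremum is taken in the extended
reals, so that it is meaningful at every `ω`. -/
def maxResidual (θ : Ω ≃ᵐ Ω) (σ ξ : Ω → ℝ) (ω : Ω) : EReal :=
  max (⨆ j : ℕ, ((residual θ σ ξ (j + 1) ω : ℝ) : EReal)) 0

open Classical in
/-- The random measure `μ^PD`: the sum over `i ≥ 1` of the Dirac masses at the positive
residual times. -/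
def pdProfile (θ : Ω ≃ᵐ Ω) (σ ξ : Ω → ℝ) (ω : Ω) : Measure ℝ :=
  Measure.sum fun i : ℕ =>
    if 0 < residual θ σ ξ (i + 1) ω then Measure.dirac (residual θ σ ξ (i + 1) ω) else 0

/-- The service profile sequence `μ^{[ζ]}` with initial profile `ζ`:
`μ_0 = ζ` and `μ_{n+1} = τ_{ξ_n} (μ_n + δ_{σ_n})`, with `ξ_n = ξ ∘ θ^n`, `σ_n = σ ∘ θ^n`. -/
def profileSeq (θ : Ω ≃ᵐ Ω) (σ ξ : Ω → ℝ) (ζ : Ω → Measure ℝ) : ℕ → Ω → Measure ℝ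
  | 0 => ζ
  | n + 1 => fun ω =>
      shift (ξ (θ^[n] ω)) (profileSeq θ σ ξ ζ n ω + Measure.dirac (σ (θ^[n] ω)))

/-- A random measure which is almost surely a (finite) profile. -/
structure IsRandomProfile (P : Measure Ω) (μ : Ω → Measure ℝ) : Prop where
  measurable : Measurable μ
  isProfile : ∀ᵐ ω ∂P, IsProfile (μ ω)

/-- `μ` is a (finite point-measure valued) solution of `μ ∘ θ = τ_ξ (μ + δ_σ)`, a.s. -/
structure IsStationaryProfile (P : Measure Ω) (θ : Ω ≃ᵐ Ω) (σ ξ : Ω → ℝ)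
    (μ : Ω → Measure ℝ) : Prop where
  isRandomProfile : IsRandomProfile P μ
  equation : ∀ᵐ ω ∂P, μ (θ ω) = shift (ξ ω) (μ ω + Measure.dirac (σ ω))

/-- Strong backwards coupling of `(X_n)` with the stationary sequence `(Y ∘ θ^n)`:
almost surely, `X_n ∘ θ^{-n} = Y` for all large `n`. -/
def StrongBackwardsCoupling {E : Type*} (P : Measure Ω) (θ : Ω ≃ᵐ Ω)
    (X : ℕ → Ω → E) (Y : Ω → E) : Prop :=
  ∀ᵐ ω ∂P, ∃ N : ℕ, ∀ n ≥ N, X n (θ.symm^[n] ω) = Y ω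

end PureDelay

end

namespace PureDelay

open Filter Topology
open scoped ENNReal

/-! ### Ergodic theory -/

section Ergodic

variable {Ω : Type*}

/-! Start the queue with `ζ` at customer `-n`, `n ≥ 1`, and look at customer `0`: the profile
consists of the atoms of `ζ ∘ θ^{-n}` pushed back by the elapsed time `S_n`, plus the positive
residuals of the `n` later arrivals (`profileSeq_backward`). Ergodicity gives `S_n ≥ εn - C`, and
integrability gives `σ_{-n} ≤ εn/2` eventually, so only finitely many residuals are positive
(`ae_exists_residual_nonpos`). Hence `μ^PD` is finite and equals the second part for large `n`; it
remains to see that no atom of `ζ ∘ θ^{-n}` exceeds `S_n`.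

If `Z(ζ) ≤ L`, this follows from `L ∘ θ^{-n} ≤ S_n` for large `n` (`maxResidual_iterate_le`). A
stationary solution equals all its backward iterates, so one good `n` suffices, and recurrence
supplies it (`IsStationaryProfile.ae_eq_pdProfile`). -/

/-- The running maximum `max_{0 ≤ k ≤ n} ∑_{j < k} f (T^j x)`, in recursive form. -/
def runningMax (T : Ω → Ω) (f : Ω → ℝ) : ℕ → Ω → ℝ
  | 0 => 0
  | n + 1 => fun x => max 0 (f x + runningMax T f n (T x))

lemma runningMax_nonneg (T : Ω → Ω) (f : Ω → ℝ) (n : ℕ) (x : Ω) : 0 ≤ runningMax T f n x := by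
  cases n with
  | zero => exact le_rfl
  | succ n => exact le_max_left _ _

lemma runningMax_le_succ (T : Ω → Ω) (f : Ω → ℝ) (n : ℕ) (x : Ω) :
    runningMax T f n x ≤ runningMax T f (n + 1) x := by
  induction n generalizing x with
  | zero => exact runningMax_nonneg T f 1 x
  | succ n ih => exact max_le_max le_rfl (by linarith [ih (T x)])

lemma runningMax_mono (T : Ω → Ω) (f : Ω → ℝ) (x : Ω) : Monotone fun n => runningMax T f n x :=
  monotone_nat_of_le_succ fun n => runningMax_le_succ T f n x

lemma birkhoffSum_le_runningMax (T : Ω → Ω) (f : Ω → ℝ) (n : ℕ) (x : Ω) :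
    birkhoffSum T f n x ≤ runningMax T f n x := by
  induction n generalizing x with
  | zero => simp [runningMax]
  | succ n ih =>
    rw [birkhoffSum_succ']
    exact le_max_of_le_right (by linarith [ih (T x)])

variable [MeasurableSpace Ω] {P : Measure Ω} {T : Ω → Ω}

lemma integrable_runningMax [IsFiniteMeasure P] (hT : MeasurePreserving T P P) {f : Ω → ℝ}
    (hf : Integrable f P) (n : ℕ) : Integrable (runningMax T f n) P := by
  induction n with
  | zero => exact integrable_zero _ _ _
  | succ n ih => exact (integrable_zero _ _ _).sup (hf.add (hT.integrable_comp_of_integrable ih))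

lemma measurable_runningMax (hT : Measurable T) {f : Ω → ℝ} (hf : Measurable f) (n : ℕ) :
    Measurable (runningMax T f n) := by
  induction n with
  | zero => exact measurable_const
  | succ n ih => exact measurable_const.max (hf.add (ih.comp hT))

/-- The Birkhoff sums of a function with negative mean are almost surely bounded above. -/
theorem ae_exists_birkhoffSum_le [IsProbabilityMeasure P] (hT : Ergodic T P) {f : Ω → ℝ}
    (hfm : Measurable f) (hf : Integrable f P) (hneg : ∫ x, f x ∂P < 0) :
    ∀ᵐ x ∂P, ∃ C : ℝ, ∀ n, birkhoffSum T f n x ≤ C := by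
  set M := runningMax T f with hM
  set A : Set Ω := {x | ∀ K : ℕ, ∃ n, (K : ℝ) < M n x} with hA
  have hMm : ∀ n, Measurable (M n) := measurable_runningMax hT.measurable hfm
  have hAm : MeasurableSet A := by
    have : A = ⋂ K : ℕ, ⋃ n, {x | (K : ℝ) < M n x} := by ext; simp [hA]
    rw [this]
    exact .iInter fun K => .iUnion fun n => measurableSet_lt measurable_const (hMm n)
  have hAinv : T ⁻¹' A = A := by
    ext x
    simp only [hA, Set.mem_preimage, Set.mem_ofPred_eq]
    constructor
    · intro h K
      obtain ⟨k, hk⟩ := exists_nat_gt ((K : ℝ) - f x)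
      obtain ⟨n, hn⟩ := h k
      exact ⟨n + 1, lt_max_of_lt_right (by linarith)⟩
    · intro h K
      obtain ⟨k, hk⟩ := exists_nat_gt ((K : ℝ) + |f x|)
      obtain ⟨n, hn⟩ := h k
      refine ⟨n, ?_⟩
      have h1 := hn.trans_le (runningMax_le_succ T f n x)
      have hK : (0 : ℝ) ≤ K := K.cast_nonneg
      rcases lt_max_iff.1 h1 with h2 | h2
      · linarith [abs_nonneg (f x)]
      · linarith [le_abs_self (f x)]
  rcases hT.toPreErgodic.ae_mem_or_ae_notMem hAm hAinv with h | h
  · exfalso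
    -- If `M n` is a.s. unbounded, then `M (n+1) - M n ∘ T = max (-M n ∘ T) f` tends to `f`,
    -- dominated by `|f|`. Its integral is nonnegative by invariance and monotonicity, contradicting
    -- the negative mean.
    have hlim : Tendsto (fun n => ∫ x, max (-M n (T x)) (f x) ∂P) atTop (𝓝 (∫ x, f x ∂P)) := by
      refine tendsto_integral_of_dominated_convergence (fun x => |f x|)
        (fun n => (((hMm n).comp hT.measurable).neg.max hfm).aestronglyMeasurable) hf.abs
        (fun n => .of_forall fun x => ?_) ?_
      · have h0 := runningMax_nonneg T f n (T x)
        rw [Real.norm_eq_abs, abs_le]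
        exact ⟨(neg_abs_le _).trans (le_max_right _ _),
          max_le (by linarith [abs_nonneg (f x)]) (le_abs_self _)⟩
      · filter_upwards [h] with x hx
        rw [← hAinv] at hx
        obtain ⟨k, hk⟩ := exists_nat_gt (|f x|)
        obtain ⟨N, hN⟩ := hx k
        refine tendsto_const_nhds.congr' ?_
        filter_upwards [eventually_ge_atTop N] with n hn
        have := runningMax_mono T f (T x) hn
        refine (max_eq_right ?_).symm
        have h2 := neg_abs_le (f x)
        simp only at this
        linarith
    refine hneg.not_ge (ge_of_tendsto' hlim fun n => ?_)
    have h1 : ∫ x, M n (T x) ∂P = ∫ x, M n x ∂P := by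
      have := integral_map (μ := P) hT.measurable.aemeasurable
        (f := M n) (hMm n).aestronglyMeasurable
      rw [hT.toMeasurePreserving.map_eq] at this
      exact this.symm
    have hi := integrable_runningMax hT.toMeasurePreserving hf
    have h2 : ∀ x, max (-M n (T x)) (f x) = M (n + 1) x - M n (T x) := fun x => by
      simp only [hM, runningMax]
      rw [← max_sub_sub_right, zero_sub, add_sub_cancel_right]
    have hiT : Integrable (fun x => M n (T x)) P :=
      hT.toMeasurePreserving.integrable_comp_of_integrable (hi n)
    rw [integral_congr_ae (.of_forall h2), integral_sub (hi (n + 1)) hiT, h1, sub_nonneg]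
    exact integral_mono (hi _) (hi _) fun x => runningMax_le_succ T f n x
  · filter_upwards [h] with x hx
    simp only [hA, Set.mem_ofPred_eq, not_forall, not_exists, not_lt] at hx
    obtain ⟨K, hK⟩ := hx
    exact ⟨K, fun n => (birkhoffSum_le_runningMax T f n x).trans (hK n)⟩

/-- The orbit of a stationary integrable variable grows sublinearly. -/
theorem ae_eventually_iterate_le [IsProbabilityMeasure P] (hT : MeasurePreserving T P P)
    {f : Ω → ℝ} (hfm : Measurable f) (hf : Integrable f P) {ε : ℝ} (hε : 0 < ε) :
    ∀ᵐ x ∂P, ∀ᶠ n : ℕ in atTop, f (T^[n] x) ≤ ε * n := by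
  -- Borel–Cantelli: integrability makes `∑ P(|f|/ε > j)` finite, and invariance moves each event to
  -- time `j`.
  let _ : MeasureSpace Ω := ⟨P⟩
  have h := ProbabilityTheory.tsum_prob_mem_Ioi_lt_top (X := fun x => |f x| / ε)
    (hf.abs.div_const ε) (fun x => by positivity)
  have hs : (∑' j : ℕ, P (T^[j] ⁻¹' {x | |f x| / ε ∈ Set.Ioi (j : ℝ)})) ≠ ∞ := by
    convert h.ne using 3 with j
    exact (hT.iterate j).measure_preimage
      (measurableSet_lt measurable_const (hfm.abs.div_const ε)).nullMeasurableSet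
  filter_upwards [ae_eventually_notMem hs] with x hx
  filter_upwards [hx] with n hn
  simp only [Set.mem_preimage, Set.mem_ofPred_eq, Set.mem_Ioi, not_lt] at hn
  rw [div_le_iff₀ hε] at hn
  linarith [le_abs_self (f (T^[n] x))]

/-- Almost every orbit visits a non-null set infinitely often. -/
theorem ae_frequently_iterate_mem [IsProbabilityMeasure P] (hT : Ergodic T P) {s : Set Ω}
    (hs : MeasurableSet s) (h0 : P s ≠ 0) : ∀ᵐ x ∂P, ∃ᶠ n in atTop, T^[n] x ∈ s := by
  set F : Set Ω := {x | ∃ᶠ n in atTop, T^[n] x ∈ s} with hF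
  have hFm : MeasurableSet F := by
    have : F = limsup (fun n => T^[n] ⁻¹' s) atTop := by
      ext x; simp [hF, mem_limsup_iff_frequently_mem]
    rw [this]
    exact .measurableSet_limsup fun n => hT.measurable.iterate n hs
  have hFinv : T ⁻¹' F = F := by
    ext x
    change (∃ᶠ n in atTop, T^[n + 1] x ∈ s) ↔ ∃ᶠ n in atTop, T^[n] x ∈ s
    conv_rhs => rw [← map_add_atTop_eq_nat 1, frequently_map]
  -- Were the invariant set `F` null, Poincaré recurrence, which puts a.e. point of `s` in `F`,
  -- would make `s` null.
  refine (hT.toPreErgodic.ae_mem_or_ae_notMem hFm hFinv).resolve_right fun h => h0 ?_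
  have hsF := hT.toMeasurePreserving.conservative.ae_mem_imp_frequently_image_mem
    hs.nullMeasurableSet
  rw [measure_eq_zero_iff_ae_notMem]
  filter_upwards [h, hsF] with x h1 h2 h3 using h1 (h2 h3)

lemma ae_forall_iterate (hT : MeasurePreserving T P P) {p : Ω → Prop} (h : ∀ᵐ x ∂P, p x) :
    ∀ᵐ x ∂P, ∀ n : ℕ, p (T^[n] x) :=
  ae_all_iff.2 fun n => (hT.iterate n).quasiMeasurePreserving.ae h

end Ergodic

/-! ### Shifts of measures and profiles -/

open Classical in
/-- The Dirac mass at `x` if `x > 0`, and `0` otherwise. -/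
noncomputable def posDirac (x : ℝ) : Measure ℝ := if 0 < x then Measure.dirac x else 0

lemma measurable_posDirac : Measurable posDirac :=
  Measurable.ite measurableSet_Ioi Measure.measurable_dirac measurable_const

lemma measurable_sub_const' (y : ℝ) : Measurable fun x : ℝ => x - y := measurable_id.sub_const y

lemma shift_add (y : ℝ) (μ ν : Measure ℝ) : shift y (μ + ν) = shift y μ + shift y ν := by
  rw [shift, Measure.restrict_add, Measure.map_add _ _ (measurable_sub_const' y)]; rfl

lemma shift_zero_measure (y : ℝ) : shift y 0 = 0 := by simp [shift]

lemma shift_sum {ι : Type*} (y : ℝ) (m : ι → Measure ℝ) :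
    shift y (Measure.sum m) = Measure.sum fun i => shift y (m i) := by
  rw [shift, Measure.restrict_sum _ measurableSet_Ioi,
    Measure.map_sum (measurable_sub_const' y).aemeasurable]; rfl

lemma shift_finset_sum {ι : Type*} (y : ℝ) (s : Finset ι) (m : ι → Measure ℝ) :
    shift y (∑ i ∈ s, m i) = ∑ i ∈ s, shift y (m i) := by
  classical
  induction s using Finset.induction_on with
  | empty => simp [shift_zero_measure]
  | insert a s ha ih => rw [Finset.sum_insert ha, Finset.sum_insert ha, shift_add, ih]

lemma shift_dirac (y x : ℝ) : shift y (Measure.dirac x) = posDirac (x - y) := by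
  classical
  rw [shift, posDirac, restrict_dirac' measurableSet_Ioi]
  by_cases h : y < x
  · simp [h, Measure.map_dirac' (measurable_sub_const' y)]
  · simp [h]

lemma shift_posDirac {y : ℝ} (hy : 0 ≤ y) (x : ℝ) :
    shift y (posDirac x) = posDirac (x - y) := by
  by_cases h : 0 < x
  · rw [posDirac, if_pos h, shift_dirac]
  · rw [posDirac, if_neg h, shift_zero_measure, posDirac, if_neg (by linarith)]

/-- As `y ≥ 0`, surviving the total shift already implies surviving the first. -/
lemma shift_shift {y : ℝ} (hy : 0 ≤ y) (z : ℝ) (μ : Measure ℝ) :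
    shift y (shift z μ) = shift (y + z) μ := by
  unfold shift
  rw [Measure.restrict_map (measurable_sub_const' z) measurableSet_Ioi,
    Measure.map_map (measurable_sub_const' y) (measurable_sub_const' z),
    Measure.restrict_restrict (measurable_sub_const' z measurableSet_Ioi)]
  congr 2
  · ext x; simp [sub_sub, add_comm]
  · ext x
    simp only [Set.mem_inter_iff, Set.mem_preimage, Set.mem_Ioi]
    constructor
    · rintro ⟨h, -⟩; linarith
    · intro h; constructor <;> linarith

lemma shift_eq_zero {y : ℝ} {μ : Measure ℝ} (h : μ (Set.Ioi y) = 0) : shift y μ = 0 := by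
  rw [shift, Measure.restrict_eq_zero.2 h, Measure.map_zero]

lemma measure_sum_eq_finset_sum {m : ℕ → Measure ℝ} {N : ℕ} (h : ∀ i ≥ N, m i = 0) :
    Measure.sum m = ∑ i ∈ Finset.range N, m i := by
  ext s hs
  rw [Measure.sum_apply _ hs, Measure.finsetSum_apply]
  refine tsum_eq_sum fun i hi => ?_
  rw [h i (by simpa using hi)]; rfl

lemma measure_sum_succ (m : ℕ → Measure ℝ) :
    Measure.sum m = Measure.sum (fun i => m (i + 1)) + m 0 := by
  ext s hs
  rw [Measure.add_apply, Measure.sum_apply _ hs, Measure.sum_apply _ hs,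
    tsum_eq_zero_add' ENNReal.summable, add_comm]

lemma isProfile_zero : IsProfile 0 := ⟨0, by simp, by simp⟩

lemma IsProfile.add {μ ν : Measure ℝ} (hμ : IsProfile μ) (hν : IsProfile ν) :
    IsProfile (μ + ν) := by
  obtain ⟨s, hs, rfl⟩ := hμ
  obtain ⟨t, ht, rfl⟩ := hν
  refine ⟨s + t, fun x hx => ?_, by simp⟩
  rcases Multiset.mem_add.1 hx with h | h
  exacts [hs x h, ht x h]

lemma isProfile_posDirac (x : ℝ) : IsProfile (posDirac x) := by
  unfold posDirac
  split_ifs with h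
  · exact ⟨{x}, by simpa using h.le, by simp⟩
  · exact isProfile_zero

lemma isProfile_finset_sum {ι : Type*} (s : Finset ι) {m : ι → Measure ℝ}
    (h : ∀ i, IsProfile (m i)) : IsProfile (∑ i ∈ s, m i) :=
  Finset.sum_induction _ _ (fun _ _ => IsProfile.add) isProfile_zero fun i _ => h i

lemma multiset_sum_dirac_apply_eq_zero {s : Multiset ℝ} {t : Set ℝ} (ht : MeasurableSet t) :
    (s.map Measure.dirac).sum t = 0 ↔ ∀ x ∈ s, x ∉ t := by
  induction s using Multiset.induction_on with
  | empty => simp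
  | cons a s ih =>
    rw [Multiset.map_cons, Multiset.sum_cons, Measure.add_apply, add_eq_zero, ih,
      Measure.dirac_apply' _ ht]
    simp

lemma IsProfile.measure_Ioi_eq_zero {μ : Measure ℝ} (hμ : IsProfile μ) {y : ℝ}
    (h : largestAtom μ ≤ y) : μ (Set.Ioi y) = 0 := by
  obtain ⟨s, -, rfl⟩ := hμ
  rw [multiset_sum_dirac_apply_eq_zero measurableSet_Ioi]
  have hset : {x : ℝ | (s.map Measure.dirac).sum {x} ≠ 0} = {x | x ∈ s} := by
    ext x
    rw [Set.mem_ofPred_eq, Ne, multiset_sum_dirac_apply_eq_zero (measurableSet_singleton x)]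
    simp
  -- Finiteness of the atom set matters: `sSup` of an unbounded set would be the default `0`.
  have hbdd : BddAbove {x | x ∈ s} := by
    classical
    have : {x | x ∈ s} = (s.toFinset : Set ℝ) := by ext; simp
    rw [this]
    exact s.toFinset.bddAbove
  intro x hx
  rw [largestAtom, hset] at h
  simpa using (le_csSup hbdd hx).trans h

/-! ### Backwards iterates of the service profile -/

variable {Ω : Type*} [MeasurableSpace Ω] {θ : Ω ≃ᵐ Ω} {σ ξ : Ω → ℝ}

/-- `∑_{j=1}^{n} ξ_{-j}`: the time between the arrivals of customers `-n` and `0`. -/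
def elapsed (θ : Ω ≃ᵐ Ω) (ξ : Ω → ℝ) (n : ℕ) (ω : Ω) : ℝ :=
  ∑ j ∈ Finset.Icc 1 n, ξ (θ.symm^[j] ω)

lemma elapsed_eq_birkhoffSum (n : ℕ) (ω : Ω) :
    elapsed θ ξ n ω = birkhoffSum θ.symm (ξ ∘ θ.symm) n ω := by
  rw [elapsed, birkhoffSum, Finset.range_eq_Ico, ← Finset.Ico_add_one_right_eq_Icc,
    Finset.sum_Ico_eq_sum_range]
  simp [add_comm 1, Function.iterate_succ_apply']

lemma residual_eq (i : ℕ) (ω : Ω) :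
    residual θ σ ξ i ω = σ (θ.symm^[i] ω) - elapsed θ ξ i ω := rfl

lemma elapsed_add (n i : ℕ) (ω : Ω) :
    elapsed θ ξ (n + i) ω = elapsed θ ξ n ω + elapsed θ ξ i (θ.symm^[n] ω) := by
  simp_rw [elapsed_eq_birkhoffSum, birkhoffSum_add]

lemma elapsed_one (ω : Ω) : elapsed θ ξ 1 ω = ξ (θ.symm ω) := by simp [elapsed]

lemma residual_add (n i : ℕ) (ω : Ω) :
    residual θ σ ξ (n + i) ω = residual θ σ ξ i (θ.symm^[n] ω) - elapsed θ ξ n ω := by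
  rw [residual_eq, residual_eq, elapsed_add, add_comm n i, Function.iterate_add_apply]
  ring

lemma residual_succ (i : ℕ) (ω : Ω) :
    residual θ σ ξ (i + 1) ω = residual θ σ ξ i (θ.symm ω) - ξ (θ.symm ω) := by
  rw [add_comm, residual_add, elapsed_one, Function.iterate_one]

lemma residual_zero (ω : Ω) : residual θ σ ξ 0 ω = σ ω := by simp [residual]

lemma iterate_apply_iterate_succ_symm (n : ℕ) (ω : Ω) :
    θ^[n] (θ.symm^[n + 1] ω) = θ.symm ω := by
  rw [Function.iterate_succ_apply]
  exact Function.LeftInverse.iterate θ.apply_symm_apply n _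

lemma profileSeq_succ_backward (ζ : Ω → Measure ℝ) (n : ℕ) (ω : Ω) :
    profileSeq θ σ ξ ζ (n + 1) (θ.symm^[n + 1] ω) =
      shift (ξ (θ.symm ω)) (profileSeq θ σ ξ ζ n (θ.symm^[n] (θ.symm ω)) +
        Measure.dirac (σ (θ.symm ω))) := by
  simp only [profileSeq]
  rw [iterate_apply_iterate_succ_symm, Function.iterate_succ_apply]

/-- The profile seen by customer `0` when the queue is started with `ζ` at customer `-(n+1)`. -/
theorem profileSeq_backward (ζ : Ω → Measure ℝ) (n : ℕ) {ω : Ω}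
    (hξ : ∀ j : ℕ, 0 < ξ (θ.symm^[j] ω)) :
    profileSeq θ σ ξ ζ (n + 1) (θ.symm^[n + 1] ω) =
      shift (elapsed θ ξ (n + 1) ω) (ζ (θ.symm^[n + 1] ω)) +
        ∑ i ∈ Finset.range (n + 1), posDirac (residual θ σ ξ (i + 1) ω) := by
  induction n generalizing ω with
  | zero =>
    simp [profileSeq, shift_add, shift_dirac, elapsed_one, residual_succ, residual_zero]
  | succ n ih =>
    have hξ' : ∀ j : ℕ, 0 < ξ (θ.symm^[j] (θ.symm ω)) := fun j => hξ (j + 1)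
    have h0 : 0 ≤ ξ (θ.symm ω) := (hξ 1).le
    rw [profileSeq_succ_backward, ih hξ',
      Function.iterate_succ_apply _ (n + 1), shift_add, shift_add, shift_shift h0, shift_dirac, shift_finset_sum,
      Finset.sum_range_succ' _ (n + 1), add_assoc]
    simp_rw [shift_posDirac h0, ← residual_succ]
    -- Customer `-1` enters as residual number `0` at `θ⁻¹ω`, which becomes residual number `1` at
    -- `ω`.
    rw [← residual_zero (θ := θ) (σ := σ) (ξ := ξ) (θ.symm ω), ← residual_succ]
    congr 2
    rw [add_comm (n + 1) 1, elapsed_add 1, elapsed_one, Function.iterate_one]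

/-- Reduces uniqueness to the queue forgetting its initial profile. -/
lemma profileSeq_eq_of_stationary {μ : Ω → Measure ℝ} (n : ℕ) {ω : Ω}
    (h : ∀ j : ℕ, μ (θ (θ.symm^[j] ω)) =
      shift (ξ (θ.symm^[j] ω)) (μ (θ.symm^[j] ω) + Measure.dirac (σ (θ.symm^[j] ω)))) :
    profileSeq θ σ ξ μ n (θ.symm^[n] ω) = μ ω := by
  induction n generalizing ω with
  | zero => rfl
  | succ n ih =>
    have h1 := h 1
    rw [Function.iterate_one, θ.apply_symm_apply] at h1
    rw [profileSeq_succ_backward, ih fun j => h (j + 1), h1]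

lemma pdProfile_eq (ω : Ω) :
    pdProfile θ σ ξ ω = Measure.sum fun i => posDirac (residual θ σ ξ (i + 1) ω) := rfl

lemma pdProfile_eq_finset_sum {ω : Ω} {N : ℕ} (h : ∀ i ≥ N, residual θ σ ξ i ω ≤ 0) :
    pdProfile θ σ ξ ω = ∑ i ∈ Finset.range N, posDirac (residual θ σ ξ (i + 1) ω) :=
  measure_sum_eq_finset_sum fun i hi => if_neg (h (i + 1) (by omega)).not_gt

/-- The equation `(*)` holds for `μ^PD` wherever `ξ ≥ 0`. -/
lemma pdProfile_equation {ω : Ω} (hξ : 0 ≤ ξ ω) :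
    pdProfile θ σ ξ (θ ω) = shift (ξ ω) (pdProfile θ σ ξ ω + Measure.dirac (σ ω)) := by
  rw [shift_add, shift_dirac, pdProfile_eq, pdProfile_eq, shift_sum, measure_sum_succ]
  simp_rw [shift_posDirac hξ, residual_succ (θ := θ) _ (θ ω), θ.symm_apply_apply, residual_zero]

lemma measurable_residual (hσ : Measurable σ) (hξ : Measurable ξ) (i : ℕ) :
    Measurable (residual θ σ ξ i) :=
  (hσ.comp (θ.symm.measurable.iterate i)).sub
    (Finset.measurable_fun_sum _ fun j _ => hξ.comp (θ.symm.measurable.iterate j))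

lemma measurable_pdProfile (hσ : Measurable σ) (hξ : Measurable ξ) :
    Measurable (pdProfile θ σ ξ) := by
  refine Measure.measurable_of_measurable_coe _ fun s hs => ?_
  simp_rw [pdProfile_eq, Measure.sum_apply _ hs]
  exact Measurable.tsum fun i => (Measure.measurable_coe hs).comp
    (measurable_posDirac.comp (measurable_residual hσ hξ _))

/-! ### Almost sure asymptotics, uniqueness and coupling -/

variable {P : Measure Ω} [IsProbabilityMeasure P]

/-- The elapsed time grows at least linearly. -/
lemma ae_exists_linear_le_elapsed (hθ : Ergodic θ P) (hξm : Measurable ξ)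
    (hξi : Integrable ξ P) (hξ : ∀ᵐ ω ∂P, 0 < ξ ω) :
    ∃ ε > 0, ∀ᵐ ω ∂P, ∃ C : ℝ, ∀ n : ℕ, ε * n - C ≤ elapsed θ ξ n ω := by
  have hpos : 0 < ∫ ω, ξ ω ∂P := by
    rw [integral_pos_iff_support_of_nonneg_ae (hξ.mono fun _ h => h.le) hξi]
    have : Function.support ξ =ᵐ[P] Set.univ :=
      eventuallyEq_univ.2 (hξ.mono fun ω h => h.ne')
    rw [measure_congr this]
    simp
  have hT := hθ.symm
  -- With half the mean as slope, `ε - ξ ∘ θ⁻¹` has mean `-ε < 0`, so its Birkhoff sums `εn - S_n`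
  -- are bounded above.
  refine ⟨(∫ ω, ξ ω ∂P) / 2, half_pos hpos, ?_⟩
  set ε := (∫ ω, ξ ω ∂P) / 2 with hε
  have hξT : Integrable (ξ ∘ θ.symm) P := hT.toMeasurePreserving.integrable_comp_of_integrable hξi
  have hint : ∫ ω, (ε - (ξ ∘ θ.symm) ω) ∂P < 0 := by
    have : ∫ ω, (ξ ∘ θ.symm) ω ∂P = ∫ ω, ξ ω ∂P :=
      hT.toMeasurePreserving.integral_comp θ.symm.measurableEmbedding ξ
    rw [integral_sub (integrable_const _) hξT, this]
    simp
    linarith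
  filter_upwards [ae_exists_birkhoffSum_le hT
    (measurable_const.sub (hξm.comp θ.symm.measurable)) ((integrable_const ε).sub hξT) hint]
    with ω ⟨C, hC⟩
  refine ⟨C, fun n => ?_⟩
  have := hC n
  rw [elapsed_eq_birkhoffSum]
  simp only [birkhoffSum, Pi.sub_apply, Finset.sum_sub_distrib, Finset.sum_const, Finset.card_range,
    nsmul_eq_mul] at this ⊢
  linarith

lemma ae_tendsto_elapsed (hθ : Ergodic θ P) (hξm : Measurable ξ)
    (hξi : Integrable ξ P) (hξ : ∀ᵐ ω ∂P, 0 < ξ ω) :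
    ∀ᵐ ω ∂P, Tendsto (fun n => elapsed θ ξ n ω) atTop atTop := by
  obtain ⟨ε, hε, h⟩ := ae_exists_linear_le_elapsed hθ hξm hξi hξ
  filter_upwards [h] with ω ⟨C, hC⟩
  refine tendsto_atTop_mono hC ?_
  exact tendsto_atTop_add_const_right _ (-C) (tendsto_natCast_atTop_atTop.const_mul_atTop hε)

lemma ae_exists_residual_nonpos (hθ : Ergodic θ P) (hσm : Measurable σ) (hξm : Measurable ξ)
    (hσi : Integrable σ P) (hξi : Integrable ξ P) (hξ : ∀ᵐ ω ∂P, 0 < ξ ω) :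
    ∀ᵐ ω ∂P, ∃ N, ∀ n ≥ N, residual θ σ ξ n ω ≤ 0 := by
  obtain ⟨ε, hε, h⟩ := ae_exists_linear_le_elapsed hθ hξm hξi hξ
  filter_upwards [h, ae_eventually_iterate_le hθ.symm.toMeasurePreserving hσm hσi (half_pos hε)]
    with ω ⟨C, hC⟩ hσω
  have hlin : Tendsto (fun n : ℕ => ε / 2 * n) atTop atTop :=
    tendsto_natCast_atTop_atTop.const_mul_atTop (half_pos hε)
  refine eventually_atTop.1 ?_
  filter_upwards [hσω, hlin.eventually_ge_atTop C] with n h1 h2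
  rw [residual_eq]
  linarith [hC n]

theorem isStationaryProfile_pdProfile (hθ : Ergodic θ P) (hσm : Measurable σ)
    (hξm : Measurable ξ) (hσi : Integrable σ P) (hξi : Integrable ξ P)
    (hξ : ∀ᵐ ω ∂P, 0 < ξ ω) : IsStationaryProfile P θ σ ξ (pdProfile θ σ ξ) where
  isRandomProfile :=
    { measurable := measurable_pdProfile hσm hξm
      isProfile := by
        filter_upwards [ae_exists_residual_nonpos hθ hσm hξm hσi hξi hξ] with ω ⟨N, hN⟩
        rw [pdProfile_eq_finset_sum hN]
        exact isProfile_finset_sum _ fun i => isProfile_posDirac _ }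
  equation := hξ.mono fun _ h => pdProfile_equation h.le

/-- Once the residual times stay nonpositive and the initial customers are gone, the backwards
profile is `μ^PD`. -/
lemma profileSeq_backward_eq_pdProfile {ζ : Ω → Measure ℝ} {n N : ℕ} {ω : Ω}
    (hξ : ∀ j : ℕ, 0 < ξ (θ.symm^[j] ω)) (hN : ∀ i ≥ N, residual θ σ ξ i ω ≤ 0) (hn : N ≤ n)
    (hn0 : 1 ≤ n) (hζ : ζ (θ.symm^[n] ω) (Set.Ioi (elapsed θ ξ n ω)) = 0) :
    profileSeq θ σ ξ ζ n (θ.symm^[n] ω) = pdProfile θ σ ξ ω := by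
  obtain ⟨m, rfl⟩ := Nat.exists_eq_add_of_le' hn0
  rw [profileSeq_backward ζ m hξ, shift_eq_zero hζ, zero_add,
    pdProfile_eq_finset_sum fun i hi => hN i (hn.trans hi)]

theorem IsStationaryProfile.ae_eq_pdProfile (hθ : Ergodic θ P) (hσm : Measurable σ)
    (hξm : Measurable ξ) (hσi : Integrable σ P) (hξi : Integrable ξ P)
    (hξ : ∀ᵐ ω ∂P, 0 < ξ ω) {μ : Ω → Measure ℝ} (hμ : IsStationaryProfile P θ σ ξ μ) :
    μ =ᵐ[P] pdProfile θ σ ξ := by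
  have hT := hθ.symm
  -- A.s. finiteness of the largest atom yields a level `M` bounding all atoms with positive
  -- probability; the backward orbit meets this event infinitely often, hence also after `S_n` has
  -- passed `M`.
  obtain ⟨M, hM⟩ : ∃ M : ℕ, P {ω | μ ω (Set.Ioi (M : ℝ)) = 0} ≠ 0 := by
    by_contra! h
    have hall : ∀ᵐ ω ∂P, ∀ M : ℕ, ¬ μ ω (Set.Ioi (M : ℝ)) = 0 :=
      ae_all_iff.2 fun M => measure_eq_zero_iff_ae_notMem.1 (h M)
    obtain ⟨ω, h1, h2⟩ := (hall.and hμ.isRandomProfile.isProfile).exists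
    obtain ⟨M, hM⟩ := exists_nat_ge (largestAtom (μ ω))
    exact h1 M (h2.measure_Ioi_eq_zero hM)
  have hmeas : MeasurableSet {ω | μ ω (Set.Ioi (M : ℝ)) = 0} :=
    ((Measure.measurable_coe measurableSet_Ioi).comp hμ.isRandomProfile.measurable)
      (measurableSet_singleton 0)
  filter_upwards [ae_frequently_iterate_mem hT hmeas hM,
    ae_forall_iterate hT.toMeasurePreserving hξ,
    ae_forall_iterate hT.toMeasurePreserving hμ.equation,
    ae_tendsto_elapsed hθ hξm hξi hξ,
    ae_exists_residual_nonpos hθ hσm hξm hσi hξi hξ] with ω hfreq hpos heq htend ⟨N, hN⟩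
  obtain ⟨n, hn, hnM, hnN, hn0⟩ := (hfreq.and_eventually
    ((htend.eventually_ge_atTop (M : ℝ)).and
      ((eventually_ge_atTop N).and (eventually_ge_atTop 1)))).exists
  rw [← profileSeq_eq_of_stationary n heq]
  exact profileSeq_backward_eq_pdProfile hpos hN hnN hn0
    (measure_mono_null (Set.Ioi_subset_Ioi hnM) hn)

/-- Customers preceding `-n` have, at customer `-n`, their residual at customer `0` increased by
`S_n`; the former is at most `S_n` when the latter is nonpositive. -/
lemma maxResidual_iterate_le {N n : ℕ} {ω : Ω} (hN : ∀ i ≥ N, residual θ σ ξ i ω ≤ 0)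
    (hn : N ≤ n) (h0 : 0 ≤ elapsed θ ξ n ω) :
    maxResidual θ σ ξ (θ.symm^[n] ω) ≤ (elapsed θ ξ n ω : EReal) := by
  refine max_le (iSup_le fun j => ?_) (by exact_mod_cast h0)
  have := hN (n + (j + 1)) (by omega)
  rw [residual_add] at this
  exact_mod_cast sub_nonpos.1 this

theorem strongBackwardsCoupling_pdProfile (hθ : Ergodic θ P) (hσm : Measurable σ)
    (hξm : Measurable ξ) (hσi : Integrable σ P) (hξi : Integrable ξ P)
    (hξ : ∀ᵐ ω ∂P, 0 < ξ ω) {ζ : Ω → Measure ℝ} (hζ : IsRandomProfile P ζ)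
    (hL : ∀ᵐ ω ∂P, ((largestAtom (ζ ω) : ℝ) : EReal) ≤ maxResidual θ σ ξ ω) :
    StrongBackwardsCoupling P θ (profileSeq θ σ ξ ζ) (pdProfile θ σ ξ) := by
  have hT := hθ.symm.toMeasurePreserving
  filter_upwards [ae_forall_iterate hT hξ, ae_forall_iterate hT hL,
    ae_forall_iterate hT hζ.isProfile,
    ae_exists_residual_nonpos hθ hσm hξm hσi hξi hξ] with ω hpos hLω hprof ⟨N, hN⟩
  -- At least one step is needed: `ζ` may have an atom at `0`, which only a shift removes.
  refine ⟨max N 1, fun n hn => ?_⟩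
  have hnN : N ≤ n := (le_max_left _ _).trans hn
  have h0 : 0 ≤ elapsed θ ξ n ω := Finset.sum_nonneg fun j _ => (hpos j).le
  refine profileSeq_backward_eq_pdProfile hpos hN hnN ((le_max_right _ _).trans hn) ?_
  exact (hprof n).measure_Ioi_eq_zero
    (EReal.coe_le_coe_iff.1 ((hLω n).trans (maxResidual_iterate_le hN hnN h0)))

end PureDelay

theorem mainTheorem1 {Ω : Type*} [MeasurableSpace Ω] (P : Measure Ω) [IsProbabilityMeasure P]
    (θ : Ω ≃ᵐ Ω) (hθ : Ergodic θ P)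
    (σ ξ : Ω → ℝ) (hσm : Measurable σ) (hξm : Measurable ξ)
    (hσi : Integrable σ P) (hξi : Integrable ξ P)
    (hσ : ∀ᵐ ω ∂P, 0 ≤ σ ω) (hξ : ∀ᵐ ω ∂P, 0 < ξ ω) :
    PureDelay.IsStationaryProfile P θ σ ξ (PureDelay.pdProfile θ σ ξ) ∧
    (0 < P {ω | PureDelay.maxResidual θ σ ξ ω ≤ 0} →
      (∀ μ : Ω → Measure ℝ, PureDelay.IsStationaryProfile P θ σ ξ μ →
        μ =ᵐ[P] PureDelay.pdProfile θ σ ξ) ∧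
      (∀ ζ : Ω → Measure ℝ, PureDelay.IsRandomProfile P ζ →
        (∀ᵐ ω ∂P, ((PureDelay.largestAtom (ζ ω) : ℝ) : EReal) ≤
          PureDelay.maxResidual θ σ ξ ω) →
        PureDelay.StrongBackwardsCoupling P θ (PureDelay.profileSeq θ σ ξ ζ)
          (PureDelay.pdProfile θ σ ξ))) := by
  refine ⟨PureDelay.isStationaryProfile_pdProfile hθ hσm hξm hσi hξi hξ, fun _ => ⟨?_, ?_⟩⟩
  · exact fun μ hμ => hμ.ae_eq_pdProfile hθ hσm hξm hσi hξi hξ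
  · exact fun ζ hζ hL =>
      PureDelay.strongBackwardsCoupling_pdProfile hθ hσm hξm hσi hξi hξ hζ hL
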